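/- **Proposition 7.3.** *Partitions.* A two-colored partition $p$ consists of finitely many (possibly zero) upper points and finitely many (possibly zero) lower points, each row ordered from left to right and each point colored white ($\circ$) or black ($\bullet$), together with a decomposition of the set of all points into non-empty disjoint subsets, the blocks of $p$. Let $\mathcal P^{\circ\bullet}$ be the set of all two-colored partitions. A category is a set $\mathcal C\subseteq\mathcal P^{\circ\bullet}$ which is closed under tensor products (horizontal concatenation), involution (reflection at the horizontal axis) and composition (vertical concatenation, defined when the colorings of the two adjacent rows agree; points of the two outer rows share a block if and only if they are connected through the stacked diagrams), and which contains the two identity partitions (one upper and one lower point of the same color, forming one block) and the two pair partitions (no upper points, and two lower points colored $\circ\bullet$ or $\bullet\circ$, forming one block). A category $\mathcal C$ is called case $\mathcal O$ if it contains neither the partition with no upper points and two lower points colored $\circ\bullet$, each a singleton block, nor the partition with no upper points and four lower points colored $\circ\bullet\circ\bullet$, all in one block. *Colors and distances.* The normalized color of a lower point is its color, and the normalized color of an upper point is the inverse of its color. For a set $S$ of points of $p$, the color sum $\sigma_p(S)$ is the number of points in $S$ of normalized color $\circ$ minus the number of points in $S$ of normalized color $\bullet$. The total color sum $\Sigma(p)$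 is the color sum of the set of all points of $p$. The points of $p$ are ordered cyclically by running through the lower row from left to right and then through the upper row from right to left; for points $\alpha\neq\beta$ let $]\alpha,\beta[_p$ and $]\alpha,\beta]_p$ be the corresponding intervals. The color distance is $\delta_p(\alpha,\beta)=\sigma_p(]\alpha,\beta]_p)$ if $\alpha$ and $\beta$ have the same normalized color, and $\delta_p(\alpha,\beta)=\sigma_p(]\alpha,\beta[_p)$ otherwise. *Parameters.* For $\mathcal C\subseteq\mathcal P^{\circ\bullet}$ put $\Sigma(\mathcal C)=\{\Sigma(p)\mid p\in\mathcal C\}$. Let $L(\mathcal C)$, respectively $K(\mathcal C)$, be the set of all $\delta_p(\alpha,\beta)$, where $p\in\mathcal C$ and where $\alpha\neq\beta$ are points of the same block $B$ of $p$ with $]\alpha,\beta[_p\cap B=\emptyset$ and with $\sigma_p(\{\alpha,\beta\})\neq 0$, respectively $\sigma_p(\{\alpha,\beta\})=0$. *Statement.* Let $\mathcal C\subseteq\mathcal P^{\circ\bullet}$ be a case $\mathcal O$ category and let $m\geq 1$ be an integer. (a) If $L(\mathcal C)=\emptyset$ and $K(\mathcal C)=m\mathbb Z$, then $\Sigma(\mathcal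 C)=\{0\}$. (b) If $L(\mathcal C)=K(\mathcal C)=m\mathbb Z$, or if $L(\mathcal C)=m+2m\mathbb Z$ and $K(\mathcal C)=2m\mathbb Z$, then there exists an integer $u\geq 0$ such that $\Sigma(\mathcal C)=2um\mathbb Z$. -/

import Mathlib

open scoped BigOperators

namespace TwoColored

/-- The two colors: white and black. -/
inductive Color : Type
  | white
  | black
deriving DecidableEq

/-- The inverse color. -/
def Color.inv : Color → Color
  | .white => .black
  | .black => .white

/-- White counts as one, black as minus one. -/
def Color.sign : Color → ℤ
  | .white => 1
  | .black => -1

/-- A two-colored partition: a row of `up` upper points and a row of `lo` lower points, both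
numbered from left to right and both colored, and a decomposition of the set of all points into
blocks, given as the equivalence relation of lying in the same block. -/
structure ColoredPartition : Type where
  up : ℕ
  lo : ℕ
  upColor : Fin up → Color
  loColor : Fin lo → Color
  rel : Setoid (Fin up ⊕ Fin lo)

namespace ColoredPartition

/-- The set of all points; `Sum.inl` marks the upper and `Sum.inr` the lower ones. -/
abbrev Point (p : ColoredPartition) : Type := Fin p.up ⊕ Fin p.lo

/-- The blocks are the equivalence classes. -/
def blocks (p : ColoredPartition) : Set (Set p.Point) := p.rel.classes

/-- The normalized color of a lower point is its color, the one of an upper point is the inverse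
of its color. -/
def normColor (p : ColoredPartition) : p.Point → Color
  | .inl i => (p.upColor i).inv
  | .inr j => p.loColor j

/-- The color sum of a set of points: the number of its points of normalized color white minus the
number of its points of normalized color black. -/
noncomputable def colorSum (p : ColoredPartition) (S : Set p.Point) : ℤ :=
  ∑ x : p.Point, S.indicator (fun y => (p.normColor y).sign) x

/-- The total color sum. -/
noncomputable def totalColorSum (p : ColoredPartition) : ℤ := p.colorSum Set.univ

/-- The position of a point when the points are read in counter-clockwise direction, beginning at
the leftmost lower point: first the lower row from left to right, then the upper row from right
to left. -/
def pos (p : ColoredPartition) : p.Point → ℕ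
  | .inl i => p.lo + (p.up - 1 - i)
  | .inr j => j

/-- The triple `(a, x, b)` consists of distinct points and is ordered with respect to the cyclic
(counter-clockwise) order. -/
def Ordered (p : ColoredPartition) (a x b : p.Point) : Prop :=
  (p.pos a < p.pos x ∧ p.pos x < p.pos b) ∨
  (p.pos x < p.pos b ∧ p.pos b < p.pos a) ∨
  (p.pos b < p.pos a ∧ p.pos a < p.pos x)

/-- The open interval `]a, b[` of the cyclic order, for `a ≠ b`. -/
def openInterval (p : ColoredPartition) (a b : p.Point) : Set p.Point := {x | p.Ordered a x b}

/-- The half-open interval `]a, b]` of the cyclic order, for `a ≠ b`. -/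
def leftOpenInterval (p : ColoredPartition) (a b : p.Point) : Set p.Point :=
  insert b (p.openInterval a b)

/-- The color distance from `a` to `b`, for `a ≠ b`: the color sum of `]a, b]` if the normalized
colors of `a` and `b` agree, and the color sum of `]a, b[` otherwise. -/
noncomputable def colorDist (p : ColoredPartition) (a b : p.Point) : ℤ :=
  if p.normColor a = p.normColor b then p.colorSum (p.leftOpenInterval a b)
  else p.colorSum (p.openInterval a b)

/-! ### The category operations -/

/-- The disjoint union of two equivalence relations. -/
def sumSetoid {α β : Type} (r : Setoid α) (s : Setoid β) : Setoid (α ⊕ β) where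
  r := Sum.LiftRel r s
  iseqv :=
    { refl := fun x => by
        cases x with
        | inl a => exact Sum.LiftRel.inl (r.refl a)
        | inr b => exact Sum.LiftRel.inr (s.refl b)
      symm := fun h => by
        cases h with
        | inl h => exact Sum.LiftRel.inl (r.symm h)
        | inr h => exact Sum.LiftRel.inr (s.symm h)
      trans := fun h h' => by
        cases h with
        | inl h => cases h' with
          | inl h' => exact Sum.LiftRel.inl (r.trans h h')
        | inr h => cases h' with
          | inr h' => exact Sum.LiftRel.inr (s.trans h h') }

/-- Sorting the points of two horizontally concatenated diagrams according to the diagram they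
come from. -/
def tensorEquiv (k k' l l' : ℕ) :
    Fin (k + k') ⊕ Fin (l + l') ≃ (Fin k ⊕ Fin l) ⊕ (Fin k' ⊕ Fin l') :=
  (Equiv.sumCongr finSumFinEquiv.symm finSumFinEquiv.symm).trans
    (Equiv.sumSumSumComm (Fin k) (Fin k') (Fin l) (Fin l'))

/-- The tensor product: horizontal concatenation, `q` to the right of `p`. -/
def tensor (p q : ColoredPartition) : ColoredPartition where
  up := p.up + q.up
  lo := p.lo + q.lo
  upColor := Fin.append p.upColor q.upColor
  loColor := Fin.append p.loColor q.loColor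
  rel := (sumSetoid p.rel q.rel).comap (tensorEquiv p.up q.up p.lo q.lo)

/-- The adjoint (involution): reflection at the horizontal axis. -/
def adjoint (p : ColoredPartition) : ColoredPartition where
  up := p.lo
  lo := p.up
  upColor := p.loColor
  loColor := p.upColor
  rel := p.rel.comap Sum.swap

/-- The links between the points of two vertically stacked diagrams, `r` above and `s` below, on
the disjoint union of the upper row of `r`, the middle row, where the lower row of `r` and the upper
row of `s` are identified, and the lower row of `s`. -/
inductive StackLink {k n l : ℕ} (r : Setoid (Fin k ⊕ Fin n)) (s : Setoid (Fin n ⊕ Fin l)) :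
    Fin k ⊕ (Fin n ⊕ Fin l) → Fin k ⊕ (Fin n ⊕ Fin l) → Prop
  | above (a b : Fin k ⊕ Fin n) (h : r a b) :
      StackLink r s (Sum.map id Sum.inl a) (Sum.map id Sum.inl b)
  | below (a b : Fin n ⊕ Fin l) (h : s a b) : StackLink r s (Sum.inr a) (Sum.inr b)

/-- The composition of a diagram with upper coloring `u` and lower coloring `w` (above) and a
diagram with upper coloring `w` and lower coloring `v` (below): two points of the outer rows belong
to the same block if and only if they are connected in the stack of the two diagrams. -/
def comp {k n l : ℕ} (u : Fin k → Color) (v : Fin l → Color)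
    (r : Setoid (Fin k ⊕ Fin n)) (s : Setoid (Fin n ⊕ Fin l)) : ColoredPartition where
  up := k
  lo := l
  upColor := u
  loColor := v
  rel := (Relation.EqvGen.setoid (StackLink r s)).comap (Sum.map id Sum.inr)

/-- The identity partition of color `c`: one upper and one lower point, both of color `c`, in one
block. -/
def idPart (c : Color) : ColoredPartition := ⟨1, 1, ![c], ![c], ⊤⟩

/-- The pair partition: no upper points, two lower points, colored `c` and `d`, in one block. -/
def pairPart (c d : Color) : ColoredPartition := ⟨0, 2, ![], ![c, d], ⊤⟩

/-- No upper points and two lower points, white and black, each of which is a singleton block. -/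
def singletonsWB : ColoredPartition := ⟨0, 2, ![], ![.white, .black], ⊥⟩

/-- No upper points and four lower points, colored white, black, white, black, all in one block. -/
def fourWBWB : ColoredPartition := ⟨0, 4, ![], ![.white, .black, .white, .black], ⊤⟩

end ColoredPartition

open ColoredPartition

/-- Categories of two-colored partitions: sets of two-colored partitions which contain the identity
partitions and the pair partitions of two different colors and which are closed under tensor
products, under adjoints and under composition of composable pairs (where the lower row of the one
has the same coloring as the upper row of the other). -/
structure IsCategory (C : Set ColoredPartition) : Prop where
  id_mem : ∀ c : Color, idPart c ∈ C
  pair_mem : ∀ c : Color, pairPart c c.inv ∈ C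
  tensor_mem : ∀ p ∈ C, ∀ q ∈ C, tensor p q ∈ C
  adjoint_mem : ∀ p ∈ C, adjoint p ∈ C
  comp_mem : ∀ {k n l : ℕ} (u : Fin k → Color) (w : Fin n → Color) (v : Fin l → Color)
    (r : Setoid (Fin k ⊕ Fin n)) (s : Setoid (Fin n ⊕ Fin l)),
    ColoredPartition.mk k n u w r ∈ C → ColoredPartition.mk n l w v s ∈ C → comp u v r s ∈ C

/-- Case O categories. -/
structure IsCaseO (C : Set ColoredPartition) : Prop where
  isCategory : IsCategory C
  singletonsWB_notMem : singletonsWB ∉ C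
  fourWBWB_notMem : fourWBWB ∉ C

/-- The set of total color sums. -/
def setSigma (S : Set ColoredPartition) : Set ℤ := {d | ∃ p ∈ S, d = p.totalColorSum}

/-- The set of color distances between subsequent legs of the same block having the same normalized
color. -/
def setL (S : Set ColoredPartition) : Set ℤ :=
  {d | ∃ p ∈ S, ∃ B ∈ p.blocks, ∃ a ∈ B, ∃ b ∈ B, a ≠ b ∧ p.openInterval a b ∩ B = ∅ ∧
    p.colorSum {a, b} ≠ 0 ∧ d = p.colorDist a b}

/-- The set of color distances between subsequent legs of the same block having different
normalized colors. -/
def setK (S : Set ColoredPartition) : Set ℤ :=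
  {d | ∃ p ∈ S, ∃ B ∈ p.blocks, ∃ a ∈ B, ∃ b ∈ B, a ≠ b ∧ p.openInterval a b ∩ B = ∅ ∧
    p.colorSum {a, b} = 0 ∧ d = p.colorDist a b}

/-- The set `a + bℤ` of integers. -/
def progression (a b : ℤ) : Set ℤ := {x | ∃ z : ℤ, x = a + b * z}

end TwoColored

namespace TwoColored

open ColoredPartition

/-! In case O every block has exactly two points. Composing with nested pairs moves all points into
one row (`IsCategory.oneRow_of_mem`) and rotates that row (`IsCategory.rotate_mem`). Any final
segment of the row can then be glued to its mirror image (`IsCategory.double_mem`). If a point were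
a singleton block, gluing everything else would leave `singletonsWB`. If three points shared a
block, gluing twice would leave `fourWBWB`. Both are excluded (`IsCaseO.exists_partner`).

Hence each member carries a fixed-point-free involution, exchanging the two points of each block. If
`setL C` is empty, partners have opposite normalized colors, their signs cancel, and the total color
sum is zero.

For the other assertion, the total color sums form a subgroup of the integers, so it suffices that
`2 * m` divides each of them when `m` divides all color distances (`two_mul_dvd_totalColorSum`).
Read the points as a walk with steps ±1 from height 0 to the total color sum, and let the level of a
point be the lower end of its step. A color distance is a difference of levels, up to adding the
total color sum when the arc wraps around. So partners have levels congruent modulo `m`, and `m`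
divides the total color sum. The value of ⌊height / m⌋ changes, by ±1, exactly at steps whose upper
end is divisible by `m`. Partners agree in this property, so the number of changes is even, and so
is the total color sum divided by `m`. -/

theorem Color.inv_inv (c : Color) : c.inv.inv = c := by cases c <;> rfl

/-! ### Recognizing members of a category: reindexing, stacks and tensor products. -/

namespace ColoredPartition

/-- Membership only depends on the diagram, not on the way the row lengths are written. -/
theorem mem_of_cast {C : Set ColoredPartition} {p q : ColoredPartition} (hp : p ∈ C)
    (hk : q.up = p.up) (hn : q.lo = p.lo)
    (hu : ∀ i, q.upColor i = p.upColor (Fin.cast hk i))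
    (hw : ∀ i, q.loColor i = p.loColor (Fin.cast hn i))
    (hr : ∀ x y, q.rel x y ↔ p.rel (Sum.map (Fin.cast hk) (Fin.cast hn) x)
      (Sum.map (Fin.cast hk) (Fin.cast hn) y)) : q ∈ C := by
  obtain ⟨k, n, u, w, r⟩ := p
  obtain ⟨k', n', u', w', r'⟩ := q
  dsimp only at hk hn
  subst hk hn
  have e1 : u' = u := funext hu
  have e2 : w' = w := funext hw
  have e3 : r' = r := by
    ext x y
    have := hr x y
    simpa using this
  rw [e1, e2, e3]
  exact hp

/-- A criterion for a diagram `z` to be the composition of `p` (above) and `q` (below): the blocks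
of the stack are separated by `π₁` and `π₂`, and related points of `z` are connected. -/
theorem mem_of_stack {C : Set ColoredPartition} (hC : IsCategory C) {p q z : ColoredPartition}
    (hp : p ∈ C) (hq : q ∈ C) (hmid : p.lo = q.up)
    (hcol : ∀ i, q.upColor (Fin.cast hmid i) = p.loColor i)
    (hup : z.up = p.up) (hlo : z.lo = q.lo)
    (hu : ∀ i, z.upColor i = p.upColor (Fin.cast hup i))
    (hl : ∀ i, z.loColor i = q.loColor (Fin.cast hlo i))
    {T : Type*} (t : Setoid T) (π₁ : p.Point → T) (π₂ : q.Point → T)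
    (hπ : ∀ i, t (π₁ (.inr i)) (π₂ (.inl (Fin.cast hmid i))))
    (h₁ : ∀ a b, p.rel a b → t (π₁ a) (π₁ b)) (h₂ : ∀ a b, q.rel a b → t (π₂ a) (π₂ b))
    (hz : ∀ x y : z.Point,
      t (Sum.elim (fun i => π₁ (.inl (Fin.cast hup i))) (fun i => π₂ (.inr (Fin.cast hlo i))) x)
        (Sum.elim (fun i => π₁ (.inl (Fin.cast hup i))) (fun i => π₂ (.inr (Fin.cast hlo i))) y) →
      z.rel x y)
    (hconn : ∀ E : Setoid (p.Point ⊕ q.Point), (∀ a b, p.rel a b → E (.inl a) (.inl b)) →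
      (∀ a b, q.rel a b → E (.inr a) (.inr b)) →
      (∀ i, E (.inl (.inr i)) (.inr (.inl (Fin.cast hmid i)))) →
      ∀ x y : z.Point, z.rel x y →
        E (Sum.map (fun i => .inl (Fin.cast hup i)) (fun i => .inr (Fin.cast hlo i)) x)
          (Sum.map (fun i => .inl (Fin.cast hup i)) (fun i => .inr (Fin.cast hlo i)) y)) :
    z ∈ C := by
  obtain ⟨k, n, u, w, r⟩ := p
  obtain ⟨n', l, w', v, s⟩ := q
  obtain ⟨k', l', u', v', r'⟩ := z
  dsimp only at hmid hup hlo
  subst hmid hup hlo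
  obtain rfl : w' = w := funext hcol
  obtain rfl : u' = u := funext hu
  obtain rfl : v' = v := funext hl
  have key := hC.comp_mem u' w' v' r s hp hq
  convert key using 1
  unfold comp
  congr 1
  ext x y
  constructor
  · intro h
    have := hconn ((Relation.EqvGen.setoid (StackLink r s)).comap
      (Sum.elim (Sum.map id Sum.inl) Sum.inr))
      (fun a b h => Relation.EqvGen.rel _ _ (StackLink.above a b h))
      (fun a b h => Relation.EqvGen.rel _ _ (StackLink.below a b h))
      (fun i => (Relation.EqvGen.setoid (StackLink r s)).refl _) x y h
    rcases x with x | x <;> rcases y with y | y <;> exact this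
  · intro h
    apply hz
    -- The middle row is labelled by `π₂`; `hπ` makes the labels from `π₁` equivalent, so links on
    -- either side preserve the label up to `t`.
    let π : Fin k' ⊕ (Fin n ⊕ Fin l') → T := Sum.elim (fun i => π₁ (.inl i)) π₂
    have hπ1 : ∀ a : Fin k' ⊕ Fin n, t (π₁ a) (π (Sum.map id Sum.inl a)) := by
      rintro (a | a)
      · exact t.refl _
      · exact hπ a
    have main : ∀ a b, Relation.EqvGen (StackLink r s) a b → t (π a) (π b) := by
      intro a b hab
      induction hab with
      | rel a b h =>
        cases h with
        | above a b h => exact t.trans (t.symm (hπ1 a)) (t.trans (h₁ a b h) (hπ1 b))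
        | below a b h => exact h₂ a b h
      | refl => exact t.refl _
      | symm _ _ _ ih => exact t.symm ih
      | trans _ _ _ _ _ ih1 ih2 => exact t.trans ih1 ih2
    have := main _ _ h
    rcases x with x | x <;> rcases y with y | y <;> exact this

/-- The points of the left factor of a tensor product. -/
def tensorLeft (p q : ColoredPartition) : p.Point → (tensor p q).Point :=
  Sum.map (Fin.castAdd q.up) (Fin.castAdd q.lo)

/-- The points of the right factor of a tensor product. -/
def tensorRight (p q : ColoredPartition) : q.Point → (tensor p q).Point :=
  Sum.map (Fin.natAdd p.up) (Fin.natAdd p.lo)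

theorem tensorEquiv_left (p q : ColoredPartition) (a : p.Point) :
    tensorEquiv p.up q.up p.lo q.lo (tensorLeft p q a) = Sum.inl a := by
  rcases a with a | a
  · change Equiv.sumSumSumComm _ _ _ _ (Sum.inl (finSumFinEquiv.symm (Fin.castAdd _ a))) = _
    rw [finSumFinEquiv_symm_apply_castAdd]
    rfl
  · change Equiv.sumSumSumComm _ _ _ _ (Sum.inr (finSumFinEquiv.symm (Fin.castAdd _ a))) = _
    rw [finSumFinEquiv_symm_apply_castAdd]
    rfl

theorem tensorEquiv_right (p q : ColoredPartition) (a : q.Point) :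
    tensorEquiv p.up q.up p.lo q.lo (tensorRight p q a) = Sum.inr a := by
  rcases a with a | a
  · change Equiv.sumSumSumComm _ _ _ _ (Sum.inl (finSumFinEquiv.symm (Fin.natAdd _ a))) = _
    rw [finSumFinEquiv_symm_apply_natAdd]
    rfl
  · change Equiv.sumSumSumComm _ _ _ _ (Sum.inr (finSumFinEquiv.symm (Fin.natAdd _ a))) = _
    rw [finSumFinEquiv_symm_apply_natAdd]
    rfl

theorem tensor_rel_left {p q : ColoredPartition} {a b : p.Point} (h : p.rel a b) :
    (tensor p q).rel (tensorLeft p q a) (tensorLeft p q b) := by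
  change Sum.LiftRel _ _ _ _
  rw [tensorEquiv_left, tensorEquiv_left]
  exact .inl h

theorem tensor_rel_right {p q : ColoredPartition} {a b : q.Point} (h : q.rel a b) :
    (tensor p q).rel (tensorRight p q a) (tensorRight p q b) := by
  change Sum.LiftRel _ _ _ _
  rw [tensorEquiv_right, tensorEquiv_right]
  exact .inr h

/-- A map on the points of a tensor product, given on the two factors. -/
def tensorElim {T : Type*} (p q : ColoredPartition) (f : p.Point → T) (g : q.Point → T) :
    (tensor p q).Point → T :=
  fun x => Sum.elim f g (tensorEquiv p.up q.up p.lo q.lo x)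

section tensorElim

variable {T : Type*} {p q : ColoredPartition} {f : p.Point → T} {g : q.Point → T}

theorem tensorElim_rel {t : Setoid T} (hf : ∀ a b, p.rel a b → t (f a) (f b))
    (hg : ∀ a b, q.rel a b → t (g a) (g b)) (a b : (tensor p q).Point)
    (h : (tensor p q).rel a b) : t (tensorElim p q f g a) (tensorElim p q f g b) := by
  unfold tensorElim
  have h' : Sum.LiftRel p.rel q.rel (tensorEquiv p.up q.up p.lo q.lo a)
    (tensorEquiv p.up q.up p.lo q.lo b) := h
  revert h'
  generalize tensorEquiv p.up q.up p.lo q.lo a = a'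
  generalize tensorEquiv p.up q.up p.lo q.lo b = b'
  rintro (h | h)
  · exact hf _ _ h
  · exact hg _ _ h

theorem tensorElim_inl_castAdd (i : Fin p.up) :
    tensorElim p q f g (.inl (Fin.castAdd q.up i)) = f (.inl i) :=
  congrArg (Sum.elim f g) (tensorEquiv_left p q (.inl i))

theorem tensorElim_inr_castAdd (i : Fin p.lo) :
    tensorElim p q f g (.inr (Fin.castAdd q.lo i)) = f (.inr i) :=
  congrArg (Sum.elim f g) (tensorEquiv_left p q (.inr i))

theorem tensorElim_inl_natAdd (i : Fin q.up) :
    tensorElim p q f g (.inl (Fin.natAdd p.up i)) = g (.inl i) :=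
  congrArg (Sum.elim f g) (tensorEquiv_right p q (.inl i))

theorem tensorElim_inr_natAdd (i : Fin q.lo) :
    tensorElim p q f g (.inr (Fin.natAdd p.lo i)) = g (.inr i) :=
  congrArg (Sum.elim f g) (tensorEquiv_right p q (.inr i))

end tensorElim

/-- A partition without upper points. -/
def oneRow (n : ℕ) (w : Fin n → Color) (r : Setoid (Fin n)) : ColoredPartition :=
  ⟨0, n, Fin.elim0, w, r.comap (Sum.elim Fin.elim0 id)⟩

/-- The identity partition of a word. -/
def idWord (n : ℕ) (w : Fin n → Color) : ColoredPartition :=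
  ⟨n, n, w, w, Setoid.ker (Sum.elim id id)⟩

/-- The equivalence relation pairing each point with its mirror image. -/
def revSetoid (n : ℕ) : Setoid (Fin n) where
  r i j := i = j ∨ i = j.rev
  iseqv :=
    { refl := fun _ => .inl rfl
      symm := by rintro i j (rfl | rfl) <;> simp
      trans := by rintro i j k (rfl | rfl) (rfl | rfl) <;> simp }

end ColoredPartition

variable {C : Set ColoredPartition}

theorem oneRow_mem_of_cast {n n' : ℕ} {w : Fin n → Color} {r : Setoid (Fin n)}
    {w' : Fin n' → Color} {r' : Setoid (Fin n')}
    (h : oneRow n w r ∈ C) (hn : n' = n) (hw : ∀ i, w' i = w (Fin.cast hn i))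
    (hr : ∀ x y, r' x y ↔ r (Fin.cast hn x) (Fin.cast hn y)) : oneRow n' w' r' ∈ C :=
  mem_of_cast h rfl hn (fun i => i.elim0) hw (by
    rintro (x | x) (y | y)
    · exact x.elim0
    · exact x.elim0
    · exact y.elim0
    · exact hr x y)

/-! ### Identities of words and nested pairs. -/

namespace IsCategory

/-- A pair partition stacked on its own reflection leaves no points. -/
theorem empty_mem (hC : IsCategory C) (r : Setoid (Fin 0)) : oneRow 0 Fin.elim0 r ∈ C := by
  refine mem_of_stack hC (hC.pair_mem .white) (hC.adjoint_mem _ (hC.pair_mem .white)) rfl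
    (fun i => rfl) rfl rfl (fun i => i.elim0) (fun i => i.elim0) (⊤ : Setoid Unit) (fun _ => ())
    (fun _ => ()) (fun _ => trivial) (fun _ _ _ => trivial) (fun _ _ _ => trivial) ?_ ?_
  · rintro (x | x) <;> exact x.elim0
  · rintro _ _ _ _ (x | x) <;> exact x.elim0

theorem idWord_mem (hC : IsCategory C) : ∀ (n : ℕ) (w : Fin n → Color), idWord n w ∈ C
  | 0, w => mem_of_cast (hC.empty_mem ⊤) rfl rfl (fun i => i.elim0) (fun i => i.elim0)
      (by rintro (x | x) <;> exact x.elim0)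
  | n + 1, w => by
    refine mem_of_cast (hC.tensor_mem _ (hC.idWord_mem n (fun i => w i.castSucc)) _
      (hC.id_mem (w (Fin.last n)))) rfl rfl ?_ ?_ ?_
    · intro i
      refine Fin.lastCases ?_ (fun i => ?_) i
      · exact (Fin.append_right (fun i : Fin n => w i.castSucc) ![w (Fin.last n)] (0 : Fin 1)).symm
      · exact (Fin.append_left (fun i : Fin n => w i.castSucc) ![w (Fin.last n)] i).symm
    · intro i
      refine Fin.lastCases ?_ (fun i => ?_) i
      · exact (Fin.append_right (fun i : Fin n => w i.castSucc) ![w (Fin.last n)] (0 : Fin 1)).symm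
      · exact (Fin.append_left (fun i : Fin n => w i.castSucc) ![w (Fin.last n)] i).symm
    · intro x y
      constructor
      · intro h
        have key : ∀ i : Fin (n + 1), (tensor (idWord n fun i => w i.castSucc)
            (idPart (w (Fin.last n)))).rel (.inl i) (.inr i) := by
          intro i
          refine Fin.lastCases ?_ (fun i => ?_) i
          · exact tensor_rel_right (p := idWord n fun i => w i.castSucc)
              (q := idPart (w (Fin.last n))) (a := .inl (0 : Fin 1)) (b := .inr (0 : Fin 1)) trivial
          · exact tensor_rel_left (p := idWord n fun i => w i.castSucc)
              (q := idPart (w (Fin.last n))) (a := .inl i) (b := .inr i) rfl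
        rcases x with x | x <;> rcases y with y | y <;> cases (show x = y from h)
        · exact Setoid.refl' _ _
        · exact key x
        · exact Setoid.symm' _ (key x)
        · exact Setoid.refl' _ _
      · intro h
        have := tensorElim_rel (p := idWord n fun i => w i.castSucc)
          (q := idPart (w (Fin.last n))) (t := (⊥ : Setoid (Fin (n + 1))))
          (f := Sum.elim Fin.castSucc Fin.castSucc) (g := fun _ => Fin.last n)
          (by rintro (a | a) (b | b) h <;> cases (show a = b from h) <;> rfl)
          (fun _ _ _ => rfl) _ _ h
        have key : ∀ x : Fin (n + 1) ⊕ Fin (n + 1), tensorElim (idWord n fun i => w i.castSucc)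
            (idPart (w (Fin.last n))) (Sum.elim Fin.castSucc Fin.castSucc)
            (fun _ => Fin.last n) x = Sum.elim id id x := by
          rintro (i | i)
          · refine Fin.lastCases ?_ (fun i => ?_) i
            · exact tensorElim_inl_natAdd (p := idWord n fun i => w i.castSucc)
                (q := idPart (w (Fin.last n))) (0 : Fin 1)
            · exact tensorElim_inl_castAdd (p := idWord n fun i => w i.castSucc)
                (q := idPart (w (Fin.last n))) i
          · refine Fin.lastCases ?_ (fun i => ?_) i
            · exact tensorElim_inr_natAdd (p := idWord n fun i => w i.castSucc)
                (q := idPart (w (Fin.last n))) (0 : Fin 1)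
            · exact tensorElim_inr_castAdd (p := idWord n fun i => w i.castSucc)
                (q := idPart (w (Fin.last n))) i
        have h2 : ∀ x : (idWord (n + 1) w).Point, tensorElim (idWord n fun i => w i.castSucc)
            (idPart (w (Fin.last n))) (Sum.elim Fin.castSucc Fin.castSucc) (fun _ => Fin.last n)
            (Sum.map (Fin.cast rfl) (Fin.cast rfl) x) = Sum.elim id id x := by
          rintro (i | i) <;> exact key _
        exact (h2 x).symm.trans (Eq.trans this (h2 y))

/-- Induction from the inside out: the outermost pair is stacked above identity ⊗ inner nest ⊗
identity, whose upper row consists of the two outer strands only. These nests and their reflections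
are the tools for moving points between the rows. -/
theorem nestedPairs_mem (hC : IsCategory C) : ∀ (n : ℕ) (w : Fin n → Color),
    (∀ i, w i.rev = (w i).inv) → oneRow n w (revSetoid n) ∈ C
  | 0, w, _ => by
    rw [Subsingleton.elim w Fin.elim0]
    exact hC.empty_mem _
  | 1, w, hw => by
    -- A middle point would be its own mirror image, hence of a color equal to its inverse.
    have := hw 0
    rw [Subsingleton.elim (Fin.rev (0 : Fin 1)) 0] at this
    cases h : w 0 <;> rw [h] at this <;> cases this
  | n + 2, w, hw => by
    set a : ColoredPartition := idPart (w 0) with ha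
    set b : ColoredPartition := oneRow n (fun i => w i.castSucc.succ) (revSetoid n) with hb
    set d : ColoredPartition := idPart (w 0).inv with hd
    have hbC : b ∈ C := by
      refine hC.nestedPairs_mem n _ (fun i => ?_)
      rw [← hw, Fin.rev_succ, Fin.rev_castSucc, Fin.succ_castSucc]
    have hwl : w (Fin.last (n + 1)) = (w 0).inv := by rw [← hw, Fin.rev_zero]
    have hlo : n + 2 = (tensor (tensor a b) d).lo := by
      change n + 2 = 1 + n + 1
      omega
    have e0 : Fin.cast hlo 0 = Fin.castAdd 1 (Fin.castAdd n (0 : Fin 1)) := by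
      ext
      simp
    have em : ∀ i : Fin n, Fin.cast hlo i.castSucc.succ = Fin.castAdd 1 (Fin.natAdd 1 i) := by
      intro i
      ext
      simp [add_comm]
    have el : Fin.cast hlo (Fin.last (n + 1)) = Fin.natAdd (1 + n) (0 : Fin 1) := by
      ext
      simp [add_comm]
    let π₂ : (tensor (tensor a b) d).Point → Fin (n + 2) :=
      tensorElim (tensor a b) d
        (tensorElim a b (fun _ => 0) (Sum.elim Fin.elim0 fun i : Fin n => i.castSucc.succ))
        (fun _ => Fin.last (n + 1))
    have key : ∀ i : Fin (n + 2), π₂ (.inr (Fin.cast hlo i)) = i := by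
      intro i
      refine Fin.cases ?_ (fun i => Fin.lastCases ?_ (fun i => ?_) i) i
      · rw [e0]
        exact (tensorElim_inr_castAdd (p := tensor a b) (q := d) _).trans
          (tensorElim_inr_castAdd (p := a) (q := b) _)
      · rw [Fin.succ_last, el]
        exact tensorElim_inr_natAdd (p := tensor a b) (q := d) (0 : Fin 1)
      · rw [em]
        exact (tensorElim_inr_castAdd (p := tensor a b) (q := d) _).trans
          (tensorElim_inr_natAdd (p := a) (q := b) i)
    have col : ∀ i : Fin (n + 2), w i = (tensor (tensor a b) d).loColor (Fin.cast hlo i) := by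
      intro i
      refine Fin.cases ?_ (fun i => Fin.lastCases ?_ (fun i => ?_) i) i
      · rw [e0]
        exact ((Fin.append_left (Fin.append a.loColor b.loColor) d.loColor _).trans
          (Fin.append_left a.loColor b.loColor (0 : Fin 1))).symm
      · rw [Fin.succ_last, el]
        exact hwl.trans (Fin.append_right (Fin.append a.loColor b.loColor) d.loColor
          (0 : Fin 1)).symm
      · rw [em]
        exact ((Fin.append_left (Fin.append a.loColor b.loColor) d.loColor _).trans
          (Fin.append_right a.loColor b.loColor i)).symm
    refine mem_of_stack hC (hC.pair_mem (w 0))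
      (hC.tensor_mem _ (hC.tensor_mem _ (hC.id_mem (w 0)) _ hbC) _ (hC.id_mem (w 0).inv))
      (q := tensor (tensor a b) d) rfl ?_ rfl hlo (fun i => i.elim0) ?_ (revSetoid (n + 2))
      (Sum.elim Fin.elim0 ![0, Fin.last (n + 1)]) π₂ ?_ ?_ ?_ ?_ ?_
    · intro i
      change Fin 2 at i
      fin_cases i <;> rfl
    · exact col
    · intro i
      change Fin 2 at i
      fin_cases i
      · exact Setoid.refl' _ _
      · exact Setoid.refl' _ _
    · rintro (x | x) (y | y) h
      · exact x.elim0
      · exact x.elim0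
      · exact y.elim0
      · change Fin 2 at x y
        fin_cases x <;> fin_cases y
        · exact .inl rfl
        · exact .inr (Fin.rev_last _).symm
        · exact .inr (Fin.rev_zero _).symm
        · exact .inl rfl
    · apply tensorElim_rel
      · apply tensorElim_rel
        · exact fun _ _ _ => Setoid.refl' _ _
        · rintro (x | x) (y | y) h
          · exact x.elim0
          · exact x.elim0
          · exact y.elim0
          · change Fin n at x y
            rcases (show x = y ∨ x = y.rev from h) with rfl | rfl
            · exact Setoid.refl' _ _
            · right
              change y.rev.castSucc.succ = y.castSucc.succ.rev
              rw [Fin.rev_succ, Fin.rev_castSucc, Fin.succ_castSucc]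
      · exact fun _ _ _ => Setoid.refl' _ _
    · rintro (x | x) (y | y) h
      · exact x.elim0
      · exact x.elim0
      · exact y.elim0
      · change Fin (n + 2) at x y
        change revSetoid (n + 2) (π₂ (.inr (Fin.cast hlo x))) (π₂ (.inr (Fin.cast hlo y))) at h
        rw [key, key] at h
        exact h
    · intro E h₁ h₂ h₃ x y h
      -- The path runs up the left strand, along the pair on top, and down the right strand.
      have out : E (.inr (.inr (Fin.cast hlo 0))) (.inr (.inr (Fin.cast hlo (Fin.last _)))) := by
        rw [e0, el]
        have u0 := h₂ _ _ (tensor_rel_left (q := d) (tensor_rel_left (p := a) (q := b)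
          (a := .inr (0 : Fin 1)) (b := .inl (0 : Fin 1)) trivial))
        have u1 := h₂ _ _ (tensor_rel_right (p := tensor a b) (q := d)
          (a := .inr (0 : Fin 1)) (b := .inl (0 : Fin 1)) trivial)
        have v := h₁ (.inr (0 : Fin 2)) (.inr (1 : Fin 2)) trivial
        have g0 := h₃ (0 : Fin 2)
        have g1 := h₃ (1 : Fin 2)
        exact E.trans u0 (E.trans (E.symm g0) (E.trans v (E.trans g1 (E.symm u1))))
      have hr : ∀ i : Fin (n + 2),
          E (.inr (.inr (Fin.cast hlo i))) (.inr (.inr (Fin.cast hlo i.rev))) := by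
        intro i
        refine Fin.cases ?_ (fun i => Fin.lastCases ?_ (fun i => ?_) i) i
        · rw [Fin.rev_zero]
          exact out
        · rw [Fin.succ_last, Fin.rev_last]
          exact E.symm out
        · rw [Fin.rev_succ, Fin.rev_castSucc, ← Fin.succ_castSucc, em, em]
          exact h₂ _ _ (tensor_rel_left (q := d) (tensor_rel_right (p := a) (q := b)
            (a := .inr i) (b := .inr i.rev) (.inr (Fin.rev_rev i).symm)))
      rcases x with x | x
      · exact x.elim0
      rcases y with y | y
      · exact y.elim0
      change Fin (n + 2) at x y
      rcases (show x = y ∨ x = y.rev from h) with rfl | rfl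
      · exact E.refl _
      · exact E.symm (hr y)

end IsCategory

/-! ### Moving points between the rows, gluing and rotation. -/

theorem append_mirror_rev {α : Type*} {k : ℕ} (f g : Fin k → α) (h : ∀ i, g i = f i.rev)
    (j : Fin (k + k)) : Fin.append f g j.rev = Fin.append f g j := by
  have hg : g = f ∘ Fin.rev := funext h
  rw [Fin.append_rev, hg, Function.comp_assoc, Fin.rev_involutive.comp_self, Function.comp_id]
  rfl

theorem append_word_rev {k : ℕ} (f g : Fin k → Color) (h : ∀ i, g i = (f i.rev).inv)
    (j : Fin (k + k)) : Fin.append f g j.rev = (Fin.append f g j).inv := by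
  have hg : g = Color.inv ∘ f ∘ Fin.rev := funext h
  have hf : f = Color.inv ∘ g ∘ Fin.rev := by
    rw [hg]
    funext i
    simp [Color.inv_inv]
  have e : Fin.append f g j.rev = Fin.append (g ∘ Fin.rev) (f ∘ Fin.rev) j := Fin.append_rev _ _ _
  rw [e]
  refine Fin.addCases (fun i => ?_) (fun i => ?_) j
  · rw [Fin.append_left, Fin.append_left, Function.comp, h, Fin.rev_rev]
  · rw [Fin.append_right, Fin.append_right, h, Color.inv_inv]
    rfl

namespace IsCategory

/-- All upper points can be moved to the left end of the lower row. -/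
theorem oneRow_of_mem (hC : IsCategory C) {p : ColoredPartition} (hp : p ∈ C) :
    oneRow (p.up + p.lo) (Fin.append (fun i => (p.upColor i.rev).inv) p.loColor)
      (p.rel.comap (Fin.append (fun i => .inl i.rev) .inr)) ∈ C := by
  set w : Fin p.up → Color := fun i => (p.upColor i.rev).inv with hw
  set d := idWord p.up w with hd
  -- The right half of this nest closes the upper row of `p`. Its left half continues along identity
  -- strands to the lower row, reversing order and inverting colors.
  have hcup : oneRow (p.up + p.up) (Fin.append w p.upColor) (revSetoid _) ∈ C := by
    refine hC.nestedPairs_mem _ _ (append_word_rev _ _ fun i => ?_)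
    rw [hw]
    simp [Color.inv_inv]
  let π₂ : (tensor d p).Point → p.Point :=
    tensorElim d p (Sum.elim (fun i => .inl i.rev) (fun i => .inl i.rev)) id
  have key : ∀ i : Fin (p.up + p.lo),
      π₂ (.inr i) = Fin.append (fun i => Sum.inl i.rev) Sum.inr i := by
    intro i
    refine Fin.addCases (fun i => ?_) (fun i => ?_) i
    · rw [Fin.append_left]
      exact tensorElim_inr_castAdd (p := d) (q := p) i
    · rw [Fin.append_right]
      exact tensorElim_inr_natAdd (p := d) (q := p) i
  refine mem_of_stack hC hcup (hC.tensor_mem _ (hC.idWord_mem _ w) _ hp)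
    (q := tensor d p) rfl (fun _ => rfl) rfl rfl (fun i => i.elim0) (fun _ => rfl) p.rel
    (Sum.elim Fin.elim0 (Fin.append (fun i => .inl i.rev) .inl)) π₂ ?_ ?_ ?_ ?_ ?_
  · intro i
    change Fin (p.up + p.up) at i
    have : Fin.append (fun i => Sum.inl i.rev) Sum.inl i = π₂ (.inl i) := by
      refine Fin.addCases (fun i => ?_) (fun i => ?_) i
      · rw [Fin.append_left]
        exact Eq.symm (tensorElim_inl_castAdd (p := d) (q := p) i)
      · rw [Fin.append_right]
        exact Eq.symm (tensorElim_inl_natAdd (p := d) (q := p) i)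
    exact this ▸ Setoid.refl' _ _
  · rintro (x | x) (y | y) h
    · exact x.elim0
    · exact x.elim0
    · exact y.elim0
    · change Fin (p.up + p.up) at x y
      rcases (show x = y ∨ x = y.rev from h) with rfl | rfl
      · exact Setoid.refl' _ _
      · have := append_mirror_rev (fun i : Fin p.up => (Sum.inl i.rev : p.Point)) Sum.inl
          (fun i => by simp) y
        change p.rel (Fin.append _ _ y.rev) (Fin.append _ _ y)
        rw [this]
  · apply tensorElim_rel
    · rintro (x | x) (y | y) h <;> cases (show x = y from h) <;> exact Setoid.refl' _ _
    · exact fun _ _ h => h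
  · rintro (x | x) (y | y) h
    · exact x.elim0
    · exact x.elim0
    · exact y.elim0
    · change Fin (p.up + p.lo) at x y
      change p.rel (π₂ (.inr x)) (π₂ (.inr y)) at h
      rw [key, key] at h
      exact h
  · intro E h₁ h₂ h₃ x y h
    let ι : p.Point → _ := fun a => (Sum.inr (tensorRight d p a) :
      (oneRow (p.up + p.up) (Fin.append w p.upColor) (revSetoid _)).Point ⊕ (tensor d p).Point)
    have conn : ∀ i : Fin (p.up + p.lo),
        E (.inr (.inr i)) (ι (Fin.append (fun i => Sum.inl i.rev) Sum.inr i)) := by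
      intro i
      refine Fin.addCases (fun i => ?_) (fun i => ?_) i
      · rw [Fin.append_left]
        have u := h₂ _ _ (tensor_rel_left (p := d) (q := p) (a := .inr i) (b := .inl i) rfl)
        have v := h₁ (.inr (Fin.castAdd _ i)) (.inr (Fin.castAdd _ i).rev)
          (.inr (Fin.rev_rev _).symm)
        have e : (Fin.castAdd p.up i).rev = Fin.natAdd p.up i.rev := by
          ext
          simp
          omega
        have g1 := h₃ (Fin.castAdd p.up i)
        have g2 := h₃ (Fin.castAdd p.up i).rev
        rw [e] at v g2
        exact E.trans u (E.trans (E.symm g1) (E.trans v g2))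
      · rw [Fin.append_right]
        exact E.refl _
    rcases x with x | x
    · exact x.elim0
    rcases y with y | y
    · exact y.elim0
    exact E.trans (conn x) (E.trans (h₂ _ _ (tensor_rel_right h)) (E.symm (conn y)))

/-- The last points of a partition without upper points can be moved to the upper row. -/
theorem bend_mem (hC : IsCategory C) {k l : ℕ} {w : Fin (k + l) → Color}
    {r : Setoid (Fin (k + l))} (hp : oneRow (k + l) w r ∈ C) :
    ⟨l, k, fun i => (w (Fin.natAdd k i.rev)).inv, fun i => w (Fin.castAdd l i),
      r.comap (Sum.elim (fun i => Fin.natAdd k i.rev) (Fin.castAdd l))⟩ ∈ C := by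
  set p := oneRow (k + l) w r with hpdef
  set x : Fin k → Color := fun i => w (Fin.castAdd l i) with hx
  set y : Fin l → Color := fun i => w (Fin.natAdd k i) with hy
  set y' : Fin l → Color := fun i => (w (Fin.natAdd k i.rev)).inv with hy'
  set d := idWord l y' with hd
  set c := idWord k x with hc
  set e := adjoint (oneRow (l + l) (Fin.append y y') (revSetoid (l + l))) with he
  have heC : e ∈ C := hC.adjoint_mem _ (hC.nestedPairs_mem _ _ (append_word_rev _ _ fun i => rfl))
  -- The stack is `p` ⊗ identity above identity ⊗ cap. The middle row has three segments, of lengths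
  -- `k`, `l`, `l`, which the two factors bracket differently; `c1`, `c2` and `c3` locate them.
  have hmid : (tensor p d).lo = (tensor c e).up := Nat.add_assoc k l l
  have c1 : ∀ i : Fin k, Fin.cast hmid (Fin.castAdd l (Fin.castAdd l i)) =
      Fin.castAdd (l + l) i := fun i => rfl
  have c2 : ∀ i : Fin l, Fin.cast hmid (Fin.castAdd l (Fin.natAdd k i)) =
      Fin.natAdd k (Fin.castAdd l i) := fun i => rfl
  have c3 : ∀ i : Fin l, Fin.cast hmid (Fin.natAdd (k + l) i) =
      Fin.natAdd k (Fin.natAdd l i) := fun i => by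
    ext
    change k + l + (i : ℕ) = k + (l + i)
    omega
  let f : Fin l → Fin (k + l) := fun i => Fin.natAdd k i.rev
  let π₁ : (tensor p d).Point → Fin (k + l) :=
    tensorElim p d (Sum.elim Fin.elim0 id) (Sum.elim f f)
  let π₂ : (tensor c e).Point → Fin (k + l) :=
    tensorElim c e (Sum.elim (Fin.castAdd l) (Fin.castAdd l))
      (Sum.elim (Fin.append (Fin.natAdd k) f) Fin.elim0)
  have hup : l = (tensor p d).up := (Nat.zero_add l).symm
  have hcol : ∀ i : Fin (k + l + l),
      (tensor c e).upColor (Fin.cast hmid i) = (tensor p d).loColor i := by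
    intro i
    refine Fin.addCases (fun i => Fin.addCases (fun i => ?_) (fun i => ?_) i) (fun i => ?_) i
    · refine (congrArg (tensor c e).upColor (c3 i)).trans ?_
      exact (Fin.append_right c.upColor e.upColor (Fin.natAdd l i)).trans
        ((Fin.append_right y y' i).trans
        (Fin.append_right p.loColor d.loColor i).symm)
    · refine (congrArg (tensor c e).upColor (c1 i)).trans ?_
      exact (Fin.append_left c.upColor e.upColor i).trans
        (Fin.append_left p.loColor d.loColor (Fin.castAdd l i)).symm
    · refine (congrArg (tensor c e).upColor (c2 i)).trans ?_
      exact (Fin.append_right c.upColor e.upColor (Fin.castAdd l i)).trans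
        ((Fin.append_left y y' i).trans
        (Fin.append_left p.loColor d.loColor (Fin.natAdd k i)).symm)
  have hπ : ∀ i : Fin (k + l + l), π₁ (.inr i) = π₂ (.inl (Fin.cast hmid i)) := by
    intro i
    refine Fin.addCases (fun i => Fin.addCases (fun i => ?_) (fun i => ?_) i) (fun i => ?_) i
    · refine Eq.trans ?_ (congrArg (fun j => π₂ (.inl j)) (c3 i)).symm
      exact (tensorElim_inr_natAdd (p := p) (q := d) i).trans
        ((tensorElim_inl_natAdd (p := c) (q := e) (Fin.natAdd l i)).trans
          (Fin.append_right _ _ i)).symm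
    · refine Eq.trans ?_ (congrArg (fun j => π₂ (.inl j)) (c1 i)).symm
      refine (tensorElim_inr_castAdd (p := p) (q := d) (Fin.castAdd l i)).trans ?_
      exact Eq.symm (tensorElim_inl_castAdd (p := c) (q := e) i)
    · refine Eq.trans ?_ (congrArg (fun j => π₂ (.inl j)) (c2 i)).symm
      exact (tensorElim_inr_castAdd (p := p) (q := d) (Fin.natAdd k i)).trans
        ((tensorElim_inl_natAdd (p := c) (q := e) (Fin.castAdd l i)).trans
          (Fin.append_left _ _ i)).symm
  have e1 : ∀ i : Fin l, Fin.cast hup i = Fin.natAdd 0 i := fun i => by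
    ext
    simp
  have k1 : ∀ i : Fin l, π₁ (.inl (Fin.cast hup i)) = f i := fun i => by
    rw [e1]
    exact tensorElim_inl_natAdd (p := p) (q := d) i
  have k2 : ∀ i : Fin k, π₂ (.inr i) = Fin.castAdd l i :=
    fun i => tensorElim_inr_castAdd (p := c) (q := e) i
  refine mem_of_stack hC (hC.tensor_mem _ hp _ (hC.idWord_mem l y'))
    (hC.tensor_mem _ (hC.idWord_mem k x) _ heC) (p := tensor p d) (q := tensor c e) hmid hcol
    hup rfl ?_ ?_ r π₁ π₂ (fun i => hπ i ▸ Setoid.refl' _ _) ?_ ?_ ?_ ?_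
  · intro i
    change y' i = (tensor p d).upColor (Fin.cast hup i)
    rw [e1]
    exact (Fin.append_right p.upColor d.upColor i).symm
  · intro i
    exact (Fin.append_left c.loColor e.loColor i).symm
  · apply tensorElim_rel
    · rintro (x | x) (y | y) h
      · exact x.elim0
      · exact x.elim0
      · exact y.elim0
      · exact h
    · rintro (x | x) (y | y) h <;> cases (show x = y from h) <;> exact Setoid.refl' _ _
  · apply tensorElim_rel
    · rintro (x | x) (y | y) h <;> cases (show x = y from h) <;> exact Setoid.refl' _ _
    · rintro (x | x) (y | y) h
      · change Fin (l + l) at x y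
        rcases (show x = y ∨ x = y.rev from h) with rfl | rfl
        · exact Setoid.refl' _ _
        · change r (Fin.append (Fin.natAdd k) f y.rev) (Fin.append (Fin.natAdd k) f y)
          rw [append_mirror_rev _ _ fun i => rfl]
      · exact y.elim0
      · exact x.elim0
      · exact x.elim0
  · rintro (x | x) (y | y) h
    · change r (π₁ (.inl (Fin.cast hup x))) (π₁ (.inl (Fin.cast hup y))) at h
      rw [k1, k1] at h
      exact h
    · change r (π₁ (.inl (Fin.cast hup x))) (π₂ (.inr y)) at h
      rw [k1, k2] at h
      exact h
    · change r (π₂ (.inr x)) (π₁ (.inl (Fin.cast hup y))) at h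
      rw [k1, k2] at h
      exact h
    · change r (π₂ (.inr x)) (π₂ (.inr y)) at h
      rw [k2, k2] at h
      exact h
  · intro E h₁ h₂ h₃
    let ι : Fin (k + l) → (tensor p d).Point ⊕ (tensor c e).Point :=
      fun a => Sum.inl (.inr (Fin.castAdd l a))
    have hι : ∀ a b, r a b → E (ι a) (ι b) := fun a b h =>
      h₁ _ _ (tensor_rel_left (p := p) (q := d) (a := .inr a) (b := .inr b) h)
    have conn1 : ∀ i : Fin l, E (.inl (.inl (Fin.cast hup i))) (ι (f i)) := by
      intro i
      rw [e1]
      have u := h₁ _ _ (tensor_rel_right (p := p) (q := d) (a := .inl i) (b := .inr i) rfl)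
      have v := h₂ _ _ (tensor_rel_right (p := c) (q := e) (a := .inl (Fin.natAdd l i))
        (b := .inl (Fin.natAdd l i).rev) (Or.inr (Fin.rev_rev _).symm))
      have g1 := h₃ (Fin.natAdd (k + l) i)
      have g2 := h₃ (Fin.castAdd l (Fin.natAdd k i.rev))
      have e2 : (Fin.natAdd l i).rev = Fin.castAdd l i.rev := by
        ext
        simp
        omega
      rw [c3] at g1
      rw [e2] at v
      exact E.trans u (E.trans g1 (E.trans v (E.symm g2)))
    have conn2 : ∀ i : Fin k, E (.inr (.inr i)) (ι (Fin.castAdd l i)) := by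
      intro i
      have u := h₂ _ _ (tensor_rel_left (p := c) (q := e) (a := .inr i) (b := .inl i) rfl)
      have g := h₃ (Fin.castAdd l (Fin.castAdd l i))
      exact E.trans u (E.symm g)
    rintro (x | x) (y | y) h
    · exact E.trans (conn1 x) (E.trans (hι _ _ h) (E.symm (conn1 y)))
    · exact E.trans (conn1 x) (E.trans (hι _ _ h) (E.symm (conn2 y)))
    · exact E.trans (conn2 x) (E.trans (hι _ _ h) (E.symm (conn1 y)))
    · exact E.trans (conn2 x) (E.trans (hι _ _ h) (E.symm (conn2 y)))

end IsCategory

/-- The relation on two copies of the points of a row which arises when the last `l` points of the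
copies are glued. -/
def doubleSetoid {k l : ℕ} (r : Setoid (Fin (k + l))) : Setoid (Fin (k + l) × Bool) where
  -- Different copies are joined only through a block that reaches the glued points.
  r a b := r a.1 b.1 ∧ (a.2 = b.2 ∨ ∃ z : Fin l, r a.1 (Fin.natAdd k z))
  iseqv :=
    { refl := fun a => ⟨r.refl _, .inl rfl⟩
      symm := by
        rintro a b ⟨h, h' | ⟨z, h'⟩⟩
        · exact ⟨r.symm h, .inl h'.symm⟩
        · exact ⟨r.symm h, .inr ⟨z, r.trans (r.symm h) h'⟩⟩
      trans := by
        rintro a b c ⟨h, h' | ⟨z, h'⟩⟩ ⟨g, g' | ⟨y, g'⟩⟩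
        · exact ⟨r.trans h g, .inl (h'.trans g')⟩
        · exact ⟨r.trans h g, .inr ⟨y, r.trans h g'⟩⟩
        · exact ⟨r.trans h g, .inr ⟨z, h'⟩⟩
        · exact ⟨r.trans h g, .inr ⟨z, h'⟩⟩ }

namespace IsCategory

/-- Two mirror images of a partition without upper points can be glued along the last points. -/
theorem double_mem (hC : IsCategory C) {k l : ℕ} {w : Fin (k + l) → Color}
    {r : Setoid (Fin (k + l))} (hp : oneRow (k + l) w r ∈ C) :
    oneRow (k + k) (Fin.append (fun i => (w (Fin.castAdd l i.rev)).inv)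
      (fun i => w (Fin.castAdd l i))) ((doubleSetoid r).comap
        (Fin.append (fun i => (Fin.castAdd l i.rev, false)) fun i => (Fin.castAdd l i, true))) ∈
      C := by
  have hR := hC.bend_mem hp
  set f : Fin l ⊕ Fin k → Fin (k + l) :=
    Sum.elim (fun i => Fin.natAdd k i.rev) (Fin.castAdd l) with hf
  set x : Fin k → Color := fun i => w (Fin.castAdd l i) with hx
  set g : Fin k ⊕ Fin k → Fin (k + l) × Bool :=
    Sum.elim (fun i => (Fin.castAdd l i, false)) (fun i => (Fin.castAdd l i, true)) with hg
  -- With the last `l` points bent upwards, the reflected diagram is stacked above the diagram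
  -- itself, so these points form the middle row and disappear.
  have hz : (⟨k, k, x, x, (doubleSetoid r).comap g⟩ : ColoredPartition) ∈ C := by
    refine mem_of_stack hC (hC.adjoint_mem _ hR) hR rfl (fun _ => rfl) rfl rfl (fun _ => rfl)
      (fun _ => rfl) (doubleSetoid r) (fun a => (f a.swap, false)) (fun a => (f a, true))
      ?_ ?_ ?_ ?_ ?_
    · exact fun i => ⟨r.refl _, .inr ⟨_, r.refl _⟩⟩
    · exact fun a b h => ⟨h, .inl rfl⟩
    · exact fun a b h => ⟨h, .inl rfl⟩
    · rintro (a | a) (b | b) h <;> exact h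
    · intro E h₁ h₂ h₃
      have cross : ∀ i j : Fin k, r (Fin.castAdd l i) (Fin.castAdd l j) →
          (∃ z : Fin l, r (Fin.castAdd l i) (Fin.natAdd k z)) →
          E (.inl (.inl i)) (.inr (.inr j)) := by
        rintro i j h ⟨z, hz⟩
        have u := h₁ (.inl i) (.inr z.rev) (by
          change r (Fin.castAdd l i) (Fin.natAdd k z.rev.rev)
          rwa [Fin.rev_rev])
        have v := h₂ (.inl z.rev) (.inr j) (by
          change r (Fin.natAdd k z.rev.rev) (Fin.castAdd l j)
          rw [Fin.rev_rev]
          exact r.trans (r.symm hz) h)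
        exact E.trans u (E.trans (h₃ z.rev) v)
      rintro (a | a) (b | b) ⟨h, h'⟩
      · exact h₁ (.inl a) (.inl b) h
      · exact cross a b h (h'.resolve_left (by simp [hg]))
      · exact E.symm (cross b a (r.symm h) (((h'.resolve_left (by simp [hg]))).imp
          fun z hz => r.trans (r.symm h) hz))
      · exact h₂ (.inr a) (.inr b) h
  refine oneRow_mem_of_cast (hC.oneRow_of_mem hz) rfl (fun _ => rfl) ?_
  have e : ∀ i : Fin (k + k),
      Fin.append (fun i => (Fin.castAdd l (Fin.rev i), false)) (fun i => (Fin.castAdd l i, true)) i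
        = g (Fin.append (fun i => .inl i.rev) .inr i) := by
    intro i
    refine Fin.addCases (fun i => ?_) (fun i => ?_) i
    · rw [Fin.append_left, Fin.append_left]
      rfl
    · rw [Fin.append_right, Fin.append_right]
      rfl
  intro a b
  change doubleSetoid r (Fin.append _ _ a) (Fin.append _ _ b) ↔ _
  rw [e, e]
  rfl

/-- The points of a partition without upper points can be rotated. -/
theorem rotate_mem (hC : IsCategory C) {n : ℕ} {w : Fin n → Color} {r : Setoid (Fin n)}
    (hp : oneRow n w r ∈ C) (i : Fin n) :
    oneRow n (fun x => w (x + i)) (r.comap fun x => x + i) ∈ C := by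
  have main : ∀ k l : ℕ, n = k + l → (i : ℕ) = k →
      oneRow n (fun x => w (x + i)) (r.comap fun x => x + i) ∈ C := by
    intro k l hn hi
    subst hn
    -- The last `l` points go to the upper row and return at the left end. Their colors are inverted
    -- twice, hence unchanged.
    have h := hC.oneRow_of_mem (hC.bend_mem hp)
    set g : Fin (l + k) → Fin (k + l) := Fin.append (Fin.natAdd k) (Fin.castAdd l) with hg
    have e : ∀ x : Fin (k + l), x + i = g (Fin.cast (Nat.add_comm k l) x) := by
      intro x
      obtain ⟨y, rfl⟩ : ∃ y : Fin (l + k), x = Fin.cast (Nat.add_comm l k) y :=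
        ⟨Fin.cast (Nat.add_comm k l) x, rfl⟩
      have hc : Fin.cast (Nat.add_comm k l) (Fin.cast (Nat.add_comm l k) y) = y := rfl
      rw [hc]
      ext
      rw [Fin.val_add, Fin.val_cast, hi]
      refine Fin.addCases (fun y => ?_) (fun y => ?_) y
      · rw [hg, Fin.append_left, Fin.val_castAdd, Fin.val_natAdd, Nat.mod_eq_of_lt] <;> omega
      · rw [hg, Fin.append_right, Fin.val_castAdd, Fin.val_natAdd,
          show l + (y : ℕ) + k = y + (k + l) by omega, Nat.add_mod_right, Nat.mod_eq_of_lt]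
        omega
    have hw : ∀ y : Fin (l + k), w (g y) = Fin.append
        (fun j : Fin l => ((w (Fin.natAdd k j.rev.rev)).inv).inv)
        (fun j => w (Fin.castAdd l j)) y := by
      intro y
      refine Fin.addCases (fun y => ?_) (fun y => ?_) y
      · rw [hg, Fin.append_left, Fin.append_left, Fin.rev_rev, Color.inv_inv]
      · rw [hg, Fin.append_right, Fin.append_right]
    have hr : ∀ y : Fin (l + k), g y = Sum.elim (fun i : Fin l => Fin.natAdd k i.rev)
        (Fin.castAdd l) (Fin.append (fun i => .inl i.rev) .inr y) := by
      intro y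
      refine Fin.addCases (fun y => ?_) (fun y => ?_) y
      · rw [hg, Fin.append_left, Fin.append_left, Sum.elim_inl, Fin.rev_rev]
      · rw [hg, Fin.append_right, Fin.append_right, Sum.elim_inr]
    refine oneRow_mem_of_cast h (Nat.add_comm k l) ?_ ?_
    · intro x
      exact (congrArg w (e x)).trans (hw _)
    · intro x y
      change r (x + i) (y + i) ↔ _
      rw [e, e, hr, hr]
      rfl
  exact main i (n - i) (by have := i.isLt; omega) rfl

theorem exists_rotate (hC : IsCategory C) {n : ℕ} {w : Fin n → Color} {r : Setoid (Fin n)}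
    (hp : oneRow n w r ∈ C) (i : Fin n) : ∃ (w' : Fin n → Color) (r' : Setoid (Fin n)),
    oneRow n w' r' ∈ C ∧ (∀ x y : Fin n, (y : ℕ) = (x + i) % n → w' x = w y) ∧
    ∀ x y x' y' : Fin n, (x' : ℕ) = (x + i) % n → (y' : ℕ) = (y + i) % n →
      (r' x y ↔ r x' y') := by
  refine ⟨_, _, hC.rotate_mem hp i, fun x y h => ?_, fun x y x' y' hx hy => ?_⟩
  · rw [show y = x + i from Fin.ext h]
  · rw [show x' = x + i from Fin.ext hx, show y' = y + i from Fin.ext hy]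
    rfl

/-! ### The excluded partitions, and why blocks in case O are pairs. -/

/-- If the first point of a member without upper points is a singleton block, then the category
contains the pair of singletons. -/
theorem singletonsWB_mem (hC : IsCategory C) {l : ℕ} {w : Fin (1 + l) → Color}
    {r : Setoid (Fin (1 + l))} (hp : oneRow (1 + l) w r ∈ C) (h : ∀ x, r 0 x → x = 0) :
    singletonsWB ∈ C := by
  -- All points but the first are glued; the two copies of the first stay unconnected because its
  -- block misses the glued part.
  have h2 : oneRow 2 ![(w 0).inv, w 0] ⊥ ∈ C := by
    refine oneRow_mem_of_cast (hC.double_mem hp) rfl ?_ ?_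
    · intro i
      fin_cases i <;> rfl
    · intro x y
      have cross : ¬ ∃ z : Fin l, r 0 (Fin.natAdd 1 z) := by
        rintro ⟨z, hz⟩
        have := congrArg Fin.val (h _ hz)
        simp at this
      fin_cases x <;> fin_cases y
      · exact iff_of_true rfl (Setoid.refl' _ _)
      · refine iff_of_false (by change ¬ ((0 : Fin 2) = 1); decide) ?_
        rintro ⟨-, h | h⟩
        · exact Bool.noConfusion h
        · exact cross h
      · refine iff_of_false (by change ¬ ((1 : Fin 2) = 0); decide) ?_
        rintro ⟨-, h | h⟩
        · exact Bool.noConfusion h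
        · exact cross h
      · exact iff_of_true rfl (Setoid.refl' _ _)
  have h3 : oneRow 2 ![.white, .black] ⊥ ∈ C := by
    cases hw : w 0
    · rw [hw] at h2
      refine oneRow_mem_of_cast (hC.rotate_mem h2 1) rfl ?_ ?_
      · intro i
        fin_cases i <;> rfl
      · intro x y
        exact (add_left_inj (1 : Fin 2)).symm
    · rwa [hw] at h2
  refine mem_of_cast h3 rfl rfl (fun i => i.elim0) (fun i => rfl) ?_
  rintro (x | x) (y | y)
  · exact x.elim0
  · exact x.elim0
  · exact y.elim0
  · exact Sum.inr_injective.eq_iff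

theorem fourWBWB_mem_of_top (hC : IsCategory C) (c : Color)
    (h : oneRow 4 ![c, c.inv, c, c.inv] ⊤ ∈ C) : fourWBWB ∈ C := by
  have h3 : oneRow 4 ![.white, .black, .white, .black] ⊤ ∈ C := by
    cases c
    · exact h
    · refine oneRow_mem_of_cast (hC.rotate_mem h 1) rfl ?_ (fun _ _ => Iff.rfl)
      intro i
      fin_cases i <;> rfl
  exact mem_of_cast h3 rfl rfl (fun i => i.elim0) (fun i => rfl) fun _ _ => Iff.rfl

/-- Gluing all but the first two points leaves four points of alternating color, and `z` connects
the two copies of the block. -/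
theorem fourWBWB_mem_of_adjacent (hC : IsCategory C) {l : ℕ} {w : Fin (2 + l) → Color}
    {r : Setoid (Fin (2 + l))} (hp : oneRow (2 + l) w r ∈ C)
    (hw : w (Fin.castAdd l 1) = (w (Fin.castAdd l 0)).inv)
    (h : r (Fin.castAdd l 0) (Fin.castAdd l 1)) (z : Fin l)
    (hz : r (Fin.castAdd l 0) (Fin.natAdd 2 z)) : fourWBWB ∈ C := by
  refine hC.fourWBWB_mem_of_top (w (Fin.castAdd l 0)) ?_
  refine oneRow_mem_of_cast (hC.double_mem hp) rfl ?_ ?_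
  · intro i
    fin_cases i
    · exact (congrArg Color.inv hw).trans (Color.inv_inv _) |>.symm
    · rfl
    · rfl
    · exact hw.symm
  · intro x y
    refine iff_of_true trivial ?_
    have key : ∀ x : Fin 4, r (Fin.castAdd l 0) (Fin.append (n := 2) (m := 2)
        (fun i => (Fin.castAdd l i.rev, false)) (fun i => (Fin.castAdd l i, true)) x).1 := by
      intro x
      fin_cases x
      · exact h
      · exact r.refl _
      · exact r.refl _
      · exact h
    exact ⟨r.trans (r.symm (key x)) (key y), .inr ⟨z, r.trans (r.symm (key x)) hz⟩⟩

/-- Three points in the same block, the first point among them. -/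
theorem fourWBWB_mem_of_three (hC : IsCategory C) {k l : ℕ} {w : Fin (k + 2 + l) → Color}
    {r : Setoid (Fin (k + 2 + l))} (hp : oneRow (k + 2 + l) w r ∈ C)
    (h : r (Fin.castAdd l 0) (Fin.castAdd l (Fin.last (k + 1)))) (z : Fin l)
    (hz : r (Fin.castAdd l 0) (Fin.natAdd (k + 2) z)) : fourWBWB ∈ C := by
  -- In the glued row the mirrored half comes first, so the two copies of point 0 sit next to each
  -- other, at positions `k + 1` and `k + 2`, with inverse colors. Rotation brings them to the
  -- front.
  obtain ⟨w', r', hp', hw', hr'⟩ := hC.exists_rotate (hC.double_mem hp)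
    ⟨k + 1, by omega⟩
  obtain ⟨w'', r'', hp'', hw'', hr''⟩ : ∃ (w'' : Fin (2 + (k + k + 2)) → Color)
      (r'' : Setoid (Fin (2 + (k + k + 2)))), oneRow _ w'' r'' ∈ C ∧
      (∀ x, w'' x = w' (Fin.cast (by omega) x)) ∧
      ∀ x y, r'' x y ↔ r' (Fin.cast (by omega) x) (Fin.cast (by omega) y) :=
    ⟨fun x => w' (Fin.cast (by omega) x), r'.comap (Fin.cast (by omega)),
      oneRow_mem_of_cast hp' (by omega) (fun _ => rfl) (fun _ _ => Iff.rfl),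
      fun _ => rfl, fun _ _ => Iff.rfl⟩
  have v0 : ((Fin.natAdd (k + 2) (0 : Fin (k + 2)) : Fin (k + 2 + (k + 2))) : ℕ) =
      k + 2 := by simp
  -- Index `k` in the tail is position `k + 2` of the rotated row, that is `2 * k + 3` before
  -- rotation: the last point, a copy of the other kept point of the block.
  refine hC.fourWBWB_mem_of_adjacent hp'' ?_ ?_ ⟨k, by omega⟩ ?_
  · rw [hw'', hw'', hw' _ (Fin.natAdd (k + 2) 0), hw' _ (Fin.castAdd (k + 2) (Fin.last (k + 1))),
      Fin.append_right, Fin.append_left, Color.inv_inv, Fin.rev_last]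
    · simp
      rw [Nat.mod_eq_of_lt]
      omega
    · simp
      rw [Nat.mod_eq_of_lt] <;> omega
  · rw [hr'', hr' _ _ (Fin.castAdd (k + 2) (Fin.last (k + 1))) (Fin.natAdd (k + 2) 0)]
    · change doubleSetoid r (Fin.append _ _ _) (Fin.append _ _ _)
      rw [Fin.append_left, Fin.append_right, Fin.rev_last]
      exact ⟨r.refl _, .inr ⟨z, hz⟩⟩
    · simp
      rw [Nat.mod_eq_of_lt]
      omega
    · simp
      rw [Nat.mod_eq_of_lt] <;> omega
  · rw [hr'', hr' _ _ (Fin.castAdd (k + 2) (Fin.last (k + 1)))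
      (Fin.natAdd (k + 2) (Fin.last (k + 1)))]
    · change doubleSetoid r (Fin.append _ _ _) (Fin.append _ _ _)
      rw [Fin.append_left, Fin.append_right, Fin.rev_last]
      exact ⟨h, .inr ⟨z, hz⟩⟩
    · simp
      rw [Nat.mod_eq_of_lt]
      omega
    · simp
      rw [Nat.mod_eq_of_lt] <;> omega

/-- The row is cut right after `b`, so `b` is the last point kept and `c` lies in the part to be
glued. -/
theorem fourWBWB_mem_of_rel (hC : IsCategory C) {n : ℕ} {w : Fin (n + 1) → Color}
    {r : Setoid (Fin (n + 1))} (hp : oneRow (n + 1) w r ∈ C) {b c : Fin (n + 1)} (hb : b ≠ 0)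
    (hbc : b < c) (h : r 0 b) (h' : r 0 c) : fourWBWB ∈ C := by
  have hb0 : 0 < (b : ℕ) := Nat.pos_of_ne_zero fun h => hb (Fin.ext h)
  have hbc' : (b : ℕ) < c := hbc
  have hc := c.isLt
  obtain ⟨k, hk⟩ : ∃ k, (b : ℕ) = k + 1 := ⟨b - 1, by omega⟩
  obtain ⟨l, hl⟩ : ∃ l, n + 1 = k + 2 + l := ⟨n + 1 - (k + 2), by omega⟩
  have e0 : Fin.cast hl.symm (Fin.castAdd l (0 : Fin (k + 2))) = 0 := Fin.ext rfl
  refine hC.fourWBWB_mem_of_three (k := k) (l := l) (w := fun x => w (Fin.cast hl.symm x))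
    (r := r.comap (Fin.cast hl.symm))
    (oneRow_mem_of_cast hp hl.symm (fun _ => rfl) (fun _ _ => Iff.rfl)) ?_ ⟨c - (k + 2), by omega⟩ ?_
  · change r (Fin.cast hl.symm _) (Fin.cast hl.symm _)
    rw [e0, show Fin.cast hl.symm (Fin.castAdd l (Fin.last (k + 1))) = b from Fin.ext hk.symm]
    exact h
  · change r (Fin.cast hl.symm _) (Fin.cast hl.symm _)
    rw [e0, show Fin.cast hl.symm (Fin.natAdd (k + 2) ⟨c - (k + 2), by omega⟩) = c from
      Fin.ext (by change k + 2 + ((c : ℕ) - (k + 2)) = c; omega)]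
    exact h'

end IsCategory

namespace IsCaseO

theorem oneRow_exists_ne (hC : IsCaseO C) {n : ℕ} {w : Fin n → Color} {r : Setoid (Fin n)}
    (hp : oneRow n w r ∈ C) (a : Fin n) : ∃ b, b ≠ a ∧ r a b := by
  by_contra! hcon
  refine hC.singletonsWB_notMem ?_
  obtain ⟨l, rfl⟩ : ∃ l, n = 1 + l := ⟨n - 1, by have := a.isLt; omega⟩
  refine hC.isCategory.singletonsWB_mem (hC.isCategory.rotate_mem hp a) fun x hx => ?_
  by_contra hx0
  have : r a (x + a) := by simpa using (show r (0 + a) (x + a) from hx)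
  exact hcon (x + a) (by simpa using hx0) this

theorem oneRow_eq_of_rel (hC : IsCaseO C) {n : ℕ} {w : Fin n → Color} {r : Setoid (Fin n)}
    (hp : oneRow n w r ∈ C) {a b c : Fin n} (hb : b ≠ a) (hc : c ≠ a) (hab : r a b)
    (hac : r a c) : b = c := by
  by_contra hbc
  refine hC.fourWBWB_notMem ?_
  obtain ⟨m, rfl⟩ : ∃ m, n = m + 1 := ⟨n - 1, by have := a.isLt; omega⟩
  have h := hC.isCategory.rotate_mem hp a
  have key : ∀ x, r a x → (r.comap fun x => x + a) 0 (x - a) := by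
    intro x hx
    change r (0 + a) (x - a + a)
    simpa using hx
  -- Rotation puts `a` first; either of the other two points may then come next.
  rcases lt_or_gt_of_ne (fun e : b - a = c - a => hbc (sub_left_injective e)) with hlt | hlt
  · exact hC.isCategory.fourWBWB_mem_of_rel h (sub_ne_zero.2 hb) hlt (key b hab) (key c hac)
  · exact hC.isCategory.fourWBWB_mem_of_rel h (sub_ne_zero.2 hc) hlt (key c hac) (key b hab)

/-- In case O, every block has exactly two points. -/
theorem exists_partner (hC : IsCaseO C) {p : ColoredPartition} (hp : p ∈ C) (a : p.Point) :
    ∃ b, b ≠ a ∧ p.rel a b ∧ ∀ c, p.rel a c → c = a ∨ c = b := by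
  have h := hC.isCategory.oneRow_of_mem hp
  set φ : Fin (p.up + p.lo) → p.Point := Fin.append (fun i => .inl i.rev) .inr with hφ
  have surj : Function.Surjective φ := by
    rintro (i | i)
    · exact ⟨Fin.castAdd _ i.rev, by rw [hφ, Fin.append_left, Fin.rev_rev]⟩
    · exact ⟨Fin.natAdd _ i, by rw [hφ, Fin.append_right]⟩
  have inj : Function.Injective φ :=
    ((Fintype.bijective_iff_surjective_and_card φ).2 ⟨surj, by simp⟩).1
  obtain ⟨x, rfl⟩ := surj a
  obtain ⟨y, hy, hxy⟩ := hC.oneRow_exists_ne h x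
  refine ⟨φ y, inj.ne hy, hxy, fun c hc => ?_⟩
  obtain ⟨z, rfl⟩ := surj c
  by_cases hz : z = x
  · exact .inl (by rw [hz])
  · exact .inr (by rw [hC.oneRow_eq_of_rel h hz hy hc hxy])

end IsCaseO

/-! ### Heights, levels and the parity argument. -/

namespace ColoredPartition

variable (p : ColoredPartition)

theorem pos_lt (x : p.Point) : p.pos x < p.lo + p.up := by
  rcases x with i | i
  · have := i.isLt
    simp only [pos]
    omega
  · have := i.isLt
    simp only [pos]
    omega

theorem pos_injective : Function.Injective p.pos := by
  rintro (i | i) (j | j) h <;> simp only [pos] at h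
  · exact congrArg Sum.inl (Fin.ext (by omega))
  · omega
  · omega
  · exact congrArg Sum.inr (Fin.ext h)

theorem sum_pos {M : Type*} [AddCommMonoid M] (f : ℕ → M) :
    ∑ x : p.Point, f (p.pos x) = ∑ i ∈ Finset.range (p.lo + p.up), f i := by
  have hb : Function.Bijective fun x : p.Point => (⟨p.pos x, p.pos_lt x⟩ : Fin (p.lo + p.up)) :=
    (Fintype.bijective_iff_injective_and_card _).2
      ⟨fun x y h => p.pos_injective (congrArg Fin.val h), by simp [add_comm]⟩
  rw [← Fin.sum_univ_eq_sum_range]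
  exact Fintype.sum_bijective _ hb _ _ fun _ => rfl

/-- The color sum of the first `i` points in the order of positions. -/
noncomputable def heightAt (i : ℕ) : ℤ :=
  ∑ x : p.Point, if p.pos x < i then (p.normColor x).sign else 0

theorem heightAt_zero : p.heightAt 0 = 0 := by simp [heightAt]

theorem totalColorSum_eq_sum : p.totalColorSum = ∑ x : p.Point, (p.normColor x).sign := by
  simp [totalColorSum, colorSum]

theorem heightAt_card : p.heightAt (p.lo + p.up) = p.totalColorSum := by
  simp [heightAt, totalColorSum_eq_sum, pos_lt]

theorem heightAt_succ (x : p.Point) :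
    p.heightAt (p.pos x + 1) = p.heightAt (p.pos x) + (p.normColor x).sign := by
  have : (p.normColor x).sign = ∑ y : p.Point, if y = x then (p.normColor y).sign else 0 := by
    simp
  rw [heightAt, heightAt, this, ← Finset.sum_add_distrib]
  refine Finset.sum_congr rfl fun y _ => ?_
  have hyx : y = x ↔ p.pos y = p.pos x := p.pos_injective.eq_iff.symm
  simp only [hyx]
  split_ifs <;> omega

/-- An interval that wraps around is the complement of a segment, which accounts for the total color
sum. -/
theorem colorSum_openInterval {a b : p.Point} (hab : a ≠ b) :
    p.colorSum (p.openInterval a b) = p.heightAt (p.pos b) - p.heightAt (p.pos a + 1) +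
      if p.pos a < p.pos b then 0 else p.totalColorSum := by
  have hne : p.pos a ≠ p.pos b := p.pos_injective.ne hab
  have mem : ∀ x, x ∈ p.openInterval a b ↔ (p.pos a < p.pos x ∧ p.pos x < p.pos b) ∨
    (p.pos x < p.pos b ∧ p.pos b < p.pos a) ∨ (p.pos b < p.pos a ∧ p.pos a < p.pos x) :=
    fun x => Iff.rfl
  classical
  by_cases h : p.pos a < p.pos b
  · rw [if_pos h, add_zero, heightAt, heightAt, ← Finset.sum_sub_distrib, colorSum]
    refine Finset.sum_congr rfl fun x _ => ?_
    simp only [Set.indicator_apply, mem]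
    split_ifs <;> omega
  · rw [if_neg h, totalColorSum_eq_sum, heightAt, heightAt, ← Finset.sum_sub_distrib,
      ← Finset.sum_add_distrib, colorSum]
    refine Finset.sum_congr rfl fun x _ => ?_
    simp only [Set.indicator_apply, mem]
    split_ifs <;> omega

theorem colorSum_insert {S : Set p.Point} {b : p.Point} (hb : b ∉ S) :
    p.colorSum (insert b S) = p.colorSum S + (p.normColor b).sign := by
  classical
  have : (p.normColor b).sign = ∑ y : p.Point, if y = b then (p.normColor y).sign else 0 := by
    simp
  rw [colorSum, colorSum, this, ← Finset.sum_add_distrib]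
  refine Finset.sum_congr rfl fun y _ => ?_
  by_cases hy : y = b
  · simp [hy, hb]
  · simp [Set.indicator_apply, hy]

theorem notMem_openInterval_left (a b : p.Point) : a ∉ p.openInterval a b := by
  rintro (h | h | h) <;> omega

theorem notMem_openInterval_right (a b : p.Point) : b ∉ p.openInterval a b := by
  rintro (h | h | h) <;> omega

/-- The lower one of the heights before and after a point. -/
noncomputable def level (x : p.Point) : ℤ :=
  p.heightAt (p.pos x) + if p.normColor x = .white then 0 else -1

/-- The case distinction in the color distance is what turns it into a difference of levels: the end
point `b` contributes exactly when it steps in the same direction as `a`. -/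
theorem colorDist_eq {a b : p.Point} (hab : a ≠ b) :
    p.colorDist a b = p.level b - p.level a +
      if p.pos a < p.pos b then 0 else p.totalColorSum := by
  rw [colorDist, leftOpenInterval, colorSum_insert _ (p.notMem_openInterval_right a b),
    colorSum_openInterval _ hab, heightAt_succ, level, level]
  cases p.normColor a <;> cases p.normColor b <;> simp [Color.sign] <;> ring

/-- The change of `⌊height / m⌋` at a point. -/
noncomputable def floorStep (m : ℤ) (x : p.Point) : ℤ :=
  p.heightAt (p.pos x + 1) / m - p.heightAt (p.pos x) / m

theorem sum_floorStep (m : ℤ) : ∑ x : p.Point, p.floorStep m x = p.totalColorSum / m := by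
  have := p.sum_pos fun i => p.heightAt (i + 1) / m - p.heightAt i / m
  rw [Finset.sum_range_sub (fun i => p.heightAt i / m), heightAt_card, heightAt_zero] at this
  simpa [floorStep] using this

theorem ediv_succ_sub {m : ℤ} (hm : 0 < m) (g : ℤ) :
    (g + 1) / m - g / m = if m ∣ g + 1 then 1 else 0 := by
  split_ifs with h
  · obtain ⟨c, hc⟩ := h
    obtain rfl : g = m * c - 1 := by omega
    have h1 : (m * c - 1) / m = c - 1 := by
      rw [Int.ediv_eq_iff_of_pos hm]
      constructor <;> nlinarith
    rw [hc, h1, Int.mul_ediv_cancel_left _ hm.ne']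
    ring
  · have h1 := Int.emod_add_mul_ediv g m
    have h2 := Int.emod_nonneg g hm.ne'
    have h3 := Int.emod_lt_of_pos g hm
    have h4 : g % m + 1 < m := by
      refine lt_of_le_of_ne h3 fun e => h ⟨g / m + 1, ?_⟩
      rw [mul_add, mul_one]
      omega
    have : (g + 1) / m = g / m := by
      rw [Int.ediv_eq_iff_of_pos hm]
      constructor <;> nlinarith
    rw [this, sub_self]

/-- A step joins `level` and `level + 1` in one direction or the other, and rounding down after
division by `m` separates these exactly when `m` divides the upper one. The direction is only a
sign, invisible modulo 2. -/
theorem floorStep_cast {m : ℤ} (hm : 0 < m) (x : p.Point) :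
    (p.floorStep m x : ZMod 2) = if m ∣ p.level x + 1 then 1 else 0 := by
  rw [floorStep, heightAt_succ, level]
  cases p.normColor x
  · have := ediv_succ_sub hm (p.heightAt (p.pos x))
    simp only [Color.sign, if_true, add_zero]
    rw [this]
    split_ifs <;> simp
  · have := ediv_succ_sub hm (p.heightAt (p.pos x) + -1)
    rw [neg_add_cancel_right] at this
    simp only [Color.sign, reduceCtorEq, if_false, neg_add_cancel_right]
    rw [← neg_sub, this]
    split_ifs <;> simp

/-- If all color distances in a pair partition are multiples of `m`, then its total color sum is
a multiple of `2 * m`. -/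
theorem two_mul_dvd_totalColorSum {m : ℤ} (hm : 0 < m) (f : p.Point → p.Point)
    (hf : ∀ x, f x ≠ x) (hff : ∀ x, f (f x) = x) (hd : ∀ x, m ∣ p.colorDist x (f x)) :
    2 * m ∣ p.totalColorSum := by
  have hlt : ∀ x, p.pos x < p.pos (f x) → m ∣ p.level (f x) - p.level x := by
    intro x hx
    simpa [colorDist_eq _ (hf x).symm, hx] using hd x
  have hlev : ∀ x, m ∣ p.level (f x) - p.level x := by
    intro x
    rcases lt_or_gt_of_ne (p.pos_injective.ne (hf x)) with h | h
    · have := hlt (f x) (by rwa [hff])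
      rw [hff] at this
      exact (dvd_sub_comm).1 this
    · exact hlt x h
  -- Of the two arcs between partners exactly one wraps around; comparing its color distance with
  -- the difference of levels isolates the total color sum.
  have htot : m ∣ p.totalColorSum := by
    rcases isEmpty_or_nonempty p.Point with h | ⟨⟨x⟩⟩
    · simp [totalColorSum_eq_sum]
    · have h1 := hd x
      have h2 := hd (f x)
      rw [hff] at h2
      rw [colorDist_eq _ (hf x).symm] at h1
      rw [colorDist_eq _ (hf x)] at h2
      rcases lt_or_gt_of_ne (p.pos_injective.ne (hf x)) with h | h
      · rw [if_neg h.not_gt] at h1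
        exact (dvd_add_right (hlev x)).1 h1
      · rw [if_neg h.not_gt] at h2
        exact (dvd_add_right ((dvd_sub_comm).1 (hlev x))).1 h2
  obtain ⟨q, hq⟩ := htot
  have hsum := p.sum_floorStep m
  rw [hq, Int.mul_ediv_cancel_left _ hm.ne'] at hsum
  -- Partners contribute equally modulo 2, hence cancel.
  have hz : ((∑ x : p.Point, p.floorStep m x : ℤ) : ZMod 2) = 0 := by
    rw [Int.cast_sum]
    refine Finset.sum_involution (fun x _ => f x) ?_ (fun x _ _ => hf x)
      (fun _ _ => Finset.mem_univ _) (fun x _ => hff x)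
    intro x _
    rw [floorStep_cast p hm, floorStep_cast p hm]
    have : m ∣ p.level (f x) + 1 ↔ m ∣ p.level x + 1 := by
      have := dvd_add_right (c := p.level x + 1) (hlev x)
      rwa [← add_assoc, sub_add_cancel] at this
    simp only [this]
    exact CharTwo.add_self_eq_zero _
  rw [hsum, ZMod.intCast_zmod_eq_zero_iff_dvd] at hz
  obtain ⟨u, hu⟩ := hz
  exact ⟨u, by rw [hq, hu]; push_cast; ring⟩

/-! ### The group of total color sums and the conclusion. -/

theorem totalColorSum_tensor (q : ColoredPartition) :
    (tensor p q).totalColorSum = p.totalColorSum + q.totalColorSum := by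
  have h1 : ∀ i : Fin p.up, (tensor p q).upColor (Fin.castAdd q.up i) = p.upColor i :=
    fun i => Fin.append_left _ _ i
  have h2 : ∀ i : Fin q.up, (tensor p q).upColor (Fin.natAdd p.up i) = q.upColor i :=
    fun i => Fin.append_right _ _ i
  have h3 : ∀ i : Fin p.lo, (tensor p q).loColor (Fin.castAdd q.lo i) = p.loColor i :=
    fun i => Fin.append_left _ _ i
  have h4 : ∀ i : Fin q.lo, (tensor p q).loColor (Fin.natAdd p.lo i) = q.loColor i :=
    fun i => Fin.append_right _ _ i
  have e : (tensor p q).totalColorSum = ∑ i : Fin (p.up + q.up),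
      ((tensor p q).upColor i).inv.sign + ∑ i : Fin (p.lo + q.lo),
      ((tensor p q).loColor i).sign := by
    rw [totalColorSum_eq_sum, Fintype.sum_sum_type]
    rfl
  rw [e, Fin.sum_univ_add, Fin.sum_univ_add, totalColorSum_eq_sum, totalColorSum_eq_sum,
    Fintype.sum_sum_type, Fintype.sum_sum_type]
  simp only [h1, h2, h3, h4, normColor]
  ring

theorem _root_.TwoColored.Color.sign_inv (c : Color) : c.inv.sign = -c.sign := by
  cases c <;> rfl

theorem totalColorSum_adjoint : p.adjoint.totalColorSum = -p.totalColorSum := by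
  have e : p.adjoint.totalColorSum = ∑ i : Fin p.lo, (p.loColor i).inv.sign +
      ∑ i : Fin p.up, (p.upColor i).sign := by
    rw [totalColorSum_eq_sum, Fintype.sum_sum_type]
    rfl
  rw [e, totalColorSum_eq_sum, Fintype.sum_sum_type]
  simp only [normColor, Color.sign_inv, Finset.sum_neg_distrib]
  ring

theorem totalColorSum_idPart (c : Color) : (idPart c).totalColorSum = 0 := by
  rw [totalColorSum_eq_sum, Fintype.sum_sum_type]
  change ∑ i : Fin 1, (![c] i).inv.sign + ∑ i : Fin 1, (![c] i).sign = 0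
  simp [Color.sign_inv]

end ColoredPartition

/-- The total color sums of a category form a subgroup of the integers. -/
theorem IsCategory.exists_setSigma_eq (hC : IsCategory C) :
    ∃ a : ℤ, setSigma C = {x | ∃ z : ℤ, x = a * z} := by
  let H : AddSubgroup ℤ :=
    { carrier := setSigma C
      add_mem' := by
        rintro _ _ ⟨p, hp, rfl⟩ ⟨q, hq, rfl⟩
        exact ⟨_, hC.tensor_mem p hp q hq, (totalColorSum_tensor p q).symm⟩
      zero_mem' := ⟨_, hC.id_mem .white, (totalColorSum_idPart _).symm⟩
      neg_mem' := by
        rintro _ ⟨p, hp, rfl⟩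
        exact ⟨_, hC.adjoint_mem p hp, (totalColorSum_adjoint p).symm⟩ }
  obtain ⟨a, ha⟩ := Int.subgroup_cyclic H
  refine ⟨a, ?_⟩
  ext x
  change x ∈ H ↔ _
  rw [ha, AddSubgroup.mem_closure_singleton]
  simp only [smul_eq_mul, Set.mem_ofPred_eq, mul_comm a, eq_comm]

/-- In a two-point block the points are consecutive legs in both directions, so every pair of
partners counts for `setL` or `setK`. -/
theorem IsCaseO.colorDist_mem (hC : IsCaseO C) {p : ColoredPartition} (hp : p ∈ C)
    {a b : p.Point} (hab : a ≠ b) (hr : p.rel a b) :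
    (p.colorSum {a, b} ≠ 0 → p.colorDist a b ∈ setL C) ∧
      (p.colorSum {a, b} = 0 → p.colorDist a b ∈ setK C) := by
  have hB : {x | p.rel x a} ∈ p.blocks := Setoid.mem_classes _ a
  have hE : p.openInterval a b ∩ {x | p.rel x a} = ∅ := by
    rw [Set.eq_empty_iff_forall_notMem]
    rintro x ⟨hx, hxa⟩
    obtain ⟨c, -, -, hc⟩ := hC.exists_partner hp a
    have hxc := hc x (p.rel.symm hxa)
    have hbc := (hc b hr).resolve_left hab.symm
    rw [← hbc] at hxc
    rcases hxc with rfl | rfl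
    · exact p.notMem_openInterval_left _ _ hx
    · exact p.notMem_openInterval_right _ _ hx
  exact ⟨fun h => ⟨p, hp, _, hB, a, p.rel.refl a, b, p.rel.symm hr, hab, hE, h, rfl⟩,
    fun h => ⟨p, hp, _, hB, a, p.rel.refl a, b, p.rel.symm hr, hab, hE, h, rfl⟩⟩

theorem ColoredPartition.colorSum_pair {p : ColoredPartition} {a b : p.Point} (h : a ≠ b) :
    p.colorSum {a, b} = (p.normColor a).sign + (p.normColor b).sign := by
  have h0 : p.colorSum (insert b ∅) = p.colorSum ∅ + (p.normColor b).sign :=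
    p.colorSum_insert (Set.notMem_empty b)
  rw [p.colorSum_insert (S := {b}) (b := a) (by simpa using h)]
  rw [LawfulSingleton.insert_empty_eq] at h0
  rw [h0]
  simp [colorSum, add_comm]

/-- In case O, passing to the other point of the block is an involution without fixed points. -/
theorem IsCaseO.exists_pairing (hC : IsCaseO C) {p : ColoredPartition} (hp : p ∈ C) :
    ∃ f : p.Point → p.Point, (∀ x, f x ≠ x) ∧ (∀ x, f (f x) = x) ∧ ∀ x, p.rel x (f x) := by
  choose f h1 h2 h3 using fun a => hC.exists_partner hp a
  exact ⟨f, h1, fun x => ((h3 (f x) x (p.rel.symm (h2 x))).resolve_left (h1 x).symm).symm, h2⟩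

/-- Partners with nonzero color sum would produce an element of `setL C`, so signs cancel along the
pairing. -/
theorem IsCaseO.setSigma_eq_of_setL_eq_empty (hC : IsCaseO C) (hL : setL C = ∅) :
    setSigma C = {0} := by
  refine Set.eq_singleton_iff_unique_mem.2
    ⟨⟨_, hC.isCategory.id_mem .white, (totalColorSum_idPart _).symm⟩, ?_⟩
  rintro _ ⟨p, hp, rfl⟩
  obtain ⟨f, hf, hff, hr⟩ := hC.exists_pairing hp
  rw [totalColorSum_eq_sum]
  refine Finset.sum_involution (fun x _ => f x) ?_ (fun x _ _ => hf x)
    (fun _ _ => Finset.mem_univ _) (fun x _ => hff x)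
  intro x _
  rw [← colorSum_pair (hf x).symm]
  by_contra h
  have := (hC.colorDist_mem hp (hf x).symm (hr x)).1 h
  rw [hL] at this
  exact this

theorem IsCaseO.exists_setSigma_eq_progression (hC : IsCaseO C) {m : ℕ} (hm : 0 < m)
    (hL : ∀ d ∈ setL C, (m : ℤ) ∣ d) (hK : ∀ d ∈ setK C, (m : ℤ) ∣ d) :
    ∃ u : ℕ, setSigma C = progression 0 (2 * u * m) := by
  obtain ⟨a, ha⟩ := hC.isCategory.exists_setSigma_eq
  have ha' : a ∈ setSigma C := by
    rw [ha]
    exact ⟨1, (mul_one a).symm⟩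
  have hdvd : 2 * (m : ℤ) ∣ a := by
    obtain ⟨p, hp, rfl⟩ := ha'
    obtain ⟨f, hf, hff, hr⟩ := hC.exists_pairing hp
    refine p.two_mul_dvd_totalColorSum (by exact_mod_cast hm) f hf hff fun x => ?_
    have h := hC.colorDist_mem hp (hf x).symm (hr x)
    by_cases hs : p.colorSum {x, f x} = 0
    · exact hK _ (h.2 hs)
    · exact hL _ (h.1 hs)
  obtain ⟨v, rfl⟩ := hdvd
  -- The generator may be negative; its sign does not affect the subgroup.
  refine ⟨v.natAbs, ?_⟩
  rw [ha]
  ext x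
  simp only [progression, Set.mem_ofPred_eq, zero_add]
  rcases Int.natAbs_eq v with hv | hv
  · rw [← hv]
    simp only [mul_right_comm]
  · have hv' : (v.natAbs : ℤ) = -v := by omega
    rw [hv']
    constructor
    · rintro ⟨z, rfl⟩
      exact ⟨-z, by ring⟩
    · rintro ⟨z, rfl⟩
      exact ⟨-z, by ring⟩

end TwoColored

theorem proposition7p3 (C : Set TwoColored.ColoredPartition) (hC : TwoColored.IsCaseO C)
    (m : ℕ) (hm : 0 < m) :
    ((TwoColored.setL C = ∅ ∧ TwoColored.setK C = TwoColored.progression 0 m) →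
      TwoColored.setSigma C = {0}) ∧
    (((TwoColored.setL C = TwoColored.progression 0 m ∧
        TwoColored.setK C = TwoColored.progression 0 m) ∨
      (TwoColored.setL C = TwoColored.progression m (2 * m) ∧
        TwoColored.setK C = TwoColored.progression 0 (2 * m))) →
      ∃ u : ℕ, TwoColored.setSigma C = TwoColored.progression 0 (2 * u * m)) := by
  refine ⟨fun h => hC.setSigma_eq_of_setL_eq_empty h.1, ?_⟩
  rintro (⟨hL, hK⟩ | ⟨hL, hK⟩)
  · refine hC.exists_setSigma_eq_progression hm ?_ ?_
    · rw [hL]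
      rintro _ ⟨z, rfl⟩
      exact ⟨z, by ring⟩
    · rw [hK]
      rintro _ ⟨z, rfl⟩
      exact ⟨z, by ring⟩
  · refine hC.exists_setSigma_eq_progression hm ?_ ?_
    · rw [hL]
      rintro _ ⟨z, rfl⟩
      -- Odd multiples of `m` are still multiples of `m`; the extra factor 2 comes from the parity
      -- argument.
      exact ⟨1 + 2 * z, by ring⟩
    · rw [hK]
      rintro _ ⟨z, rfl⟩
      exact ⟨2 * z, by ring⟩
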